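/- Let $R$ be a commutative noetherian ring. For an $R$-module $X$ write $X^*=\mathrm{Hom}_R(X,R)$. For an $R$-algebra $A$ let $A^\circ=\{f\in A^*\mid AfA\text{ is finitely generated over }R\}$, where $(af)(b)=f(ba)$ and $(fa)(b)=f(ab)$. Assume that $A$ is an $\alpha$-algebra, i.e. $A^\circ\subseteq R^A$ is a pure $R$-submodule (tensoring the inclusion with any $R$-module keeps it injective). Let $C$ be an $R$-coalgebra; $C^*$ is an $R$-algebra under convolution. Let $(A,C,\psi)$ be a right-right entwining structure, i.e. $\psi:C\otimes_RA\to A\otimes_RC$, $c\otimes a\mapsto\sum a_\psi\otimes c^\psi$, is $R$-linear with $$\sum(ab)_\psi\otimes c^\psi=\sum a_\psi b_\Psi\otimes c^{\psi\Psi},\quad \sum 1_\psi\otimes c^\psi=1\otimes c,\quad \sum a_\psi\otimes\Delta(c^\psi)=\sum a_{\psi\Psi}\otimes c_1^\Psi\otimes c_2^\psi,\quad \sum\varepsilon(c^\psi)a_\psi=\varepsilon(c)a .$$ Its entwined modules are the right $A$-modules $M$ that are right $C$-comodules with $\varrho_M(ma)=\sum m_{<0>}a_\psi\otimes m_{<1>}^\psi$;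 together with the $A$-linear $C$-colinear maps they form the category $\mathcal M_A^C(\psi)$, with morphism sets $\mathrm{Hom}_A^C$. Let $\widetilde A\subseteq C^*$ be an $R$-subalgebra (with unit $\varepsilon_C$), and let $\widetilde C\subseteq A^\circ$ be an $R$-subcoalgebra, i.e. a pure $R$-submodule with $\Delta(\widetilde C)\subseteq\widetilde C\otimes_R\widetilde C$, where $\Delta(f)$ corresponds to the functional $a\otimes b\mapsto f(ab)$ and $\varepsilon(f)=f(1)$. Assume that $\psi^*:(A\otimes_RC)^*\to(C\otimes_RA)^*$ restricts, along the canonical maps, to an $R$-linear map $\varphi:\widetilde C\otimes_R\widetilde A\to\widetilde A\otimes_R\widetilde C$. For a measuring pairing $(B,D)$, i.e. an $R$-algebra $B$, an $R$-coalgebra $D$ and an algebra morphism $B\to D^*$, $b\mapsto\langle b,-\rangle$, and an $R$-module $N$ let $\alpha_N:N\otimes_RD\to\mathrm{Hom}_R(B,N)$, $n\otimes d\mapsto[b\mapsto\langle b,d\rangle n]$. The pairing satisfies the $\alpha$-condition if $\alpha_N$ is injective for every $R$-module $N$. In that case, for a left $B$-module $N$, put $\mathrm{Rat}^D({}_BN)=\{n\in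 N\mid[b\mapsto bn]\in\alpha_N(N\otimes_RD)\}$, a right $D$-comodule through $n\mapsto\alpha^{-1}([b\mapsto bn])$. The pairing $(A,\widetilde C)$ always satisfies the $\alpha$-condition. Suppose that the pairing $(\widetilde A,C)$ satisfies the $\alpha$-condition. Then $(\widetilde A,\widetilde C,\varphi)$ is a right-right entwining structure, and $$M\mapsto M_r=\mathrm{Rat}^{\widetilde C}({}_AM^*),\qquad K\mapsto K^r=\mathrm{Rat}^{C}({}_{\widetilde A}K^*),$$ with $f\mapsto f^*$ on morphisms, are contravariant functors $\mathcal M_A^C(\psi)\to\mathcal M_{\widetilde A}^{\widetilde C}(\varphi)$ and $\mathcal M_{\widetilde A}^{\widetilde C}(\varphi)\to\mathcal M_A^C(\psi)$. Here $(ah)(m)=h(ma)$ and $(h\widetilde g)(m)=\sum h(m_{<0>})\,\widetilde g(m_{<1>})$ for $h\in M^*$, and $(\widetilde gf)(k)=f(k\widetilde g)$ and $(fa)(k)=\sum f(k_{<0>})\,k_{<1>}(a)$ for $f\in K^*$. These functors are right adjoint to each other: there are bijections $$\mathrm{Hom}_A^C(M,K^r)\cong\mathrm{Hom}_{\widetilde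 A}^{\widetilde C}(K,M_r),$$ natural in $M$ and $K$, under which $f$ and $g$ correspond if and only if $f(m)(k)=g(k)(m)$ for all $m\in M$, $k\in K$. -/

import Mathlib

universe u

open TensorProduct CategoryTheory MulOpposite

noncomputable section

namespace Entwined

section Pairings

variable {R A C : Type u} [CommRing R] [Semiring A] [Algebra R A]
  [AddCommMonoid C] [Module R C] [Coalgebra R C]
variable {M N : Type u} [AddCommMonoid M] [Module R M] [AddCommMonoid N] [Module R N]

/-- A measuring `R`-pairing `(A, C)`: an `R`-algebra morphism `κ : A → C*`, where `C*` carries the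
convolution product. -/
abbrev MeasuringPairing (R A C : Type u) [CommRing R] [Semiring A] [Algebra R A]
    [AddCommMonoid C] [Module R C] [Coalgebra R C] : Type u :=
  A →ₐ[R] WithConv (C →ₗ[R] R)

/-- The bilinear form `⟨a, c⟩ = κ(a)(c)` of a measuring pairing. -/
def form (κ : MeasuringPairing R A C) : A →ₗ[R] C →ₗ[R] R :=
  (WithConv.linearEquiv R (C →ₗ[R] R)).toLinearMap ∘ₗ κ.toLinearMap

/-- The map `α_M : M ⊗ C → Hom_R(A, M)`, `m ⊗ c ↦ [a ↦ ⟨a, c⟩ m]`. -/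
def alpha (κ : MeasuringPairing R A C) (M : Type u) [AddCommMonoid M] [Module R M] :
    M ⊗[R] C →ₗ[R] A →ₗ[R] M :=
  TensorProduct.lift <| LinearMap.mk₂ R
    (fun m c => LinearMap.toSpanSingleton R M m ∘ₗ (form κ).flip c)
    (fun m m' c => by ext; simp) (fun r m c => by ext a; exact smul_comm _ _ _)
    (fun m c c' => by ext; simp [add_smul]) (fun r m c => by ext; simp [mul_smul])

@[simp]
theorem alpha_tmul (κ : MeasuringPairing R A C) (m : M) (c : C) (a : A) :
    alpha κ M (m ⊗ₜ[R] c) a = form κ a c • m := rfl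

/-- The `α`-condition for a measuring pairing. (As `R` is a ring, an `R`-module structure on an
additive commutative monoid makes it a group, so `M` ranges over all `R`-modules; likewise a
semiring with an `R`-algebra structure is a ring.) -/
def AlphaCondition (κ : MeasuringPairing R A C) : Prop :=
  ∀ (M : Type u) [AddCommMonoid M] [Module R M], Function.Injective (alpha κ M)

/-- The rational part `Rat^C(_A N) = ρ_N⁻¹(N ⊗ C)` of a left `A`-module `N`. The module structure is
given as the algebra morphism `A → End_R(N)`; the map `ρ_N : N → Hom_R(A, N)` sends `n` to
`[a ↦ a n]`, and `N ⊗ C` is viewed inside `Hom_R(A, N)` through `α_N`. -/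
def rat (κ : MeasuringPairing R A C) (act : A →ₐ[R] Module.End R N) : Submodule R N :=
  (LinearMap.range (alpha κ N)).comap act.toLinearMap.flip

theorem mem_rat {κ : MeasuringPairing R A C} {act : A →ₐ[R] Module.End R N} {n : N} :
    n ∈ rat κ act ↔ ∃ t : N ⊗[R] C, ∀ a, alpha κ N t a = act a n := by
  simp only [rat, Submodule.mem_comap, LinearMap.mem_range, LinearMap.ext_iff]
  rfl

theorem alpha_natural (κ : MeasuringPairing R A C) (f : M →ₗ[R] N) (t : M ⊗[R] C) (a : A) :
    alpha κ N (f.rTensor C t) a = f (alpha κ M t a) := by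
  induction t with
  | zero => simp
  | tmul m c => simp
  | add x y hx hy => simp [hx, hy]

theorem form_one (κ : MeasuringPairing R A C) (c : C) :
    form κ 1 c = Coalgebra.counit (R := R) c := by
  simp [form]

theorem form_mul (κ : MeasuringPairing R A C) (a b : A) (c : C) :
    form κ (a * b) c =
      LinearMap.mul' R R (TensorProduct.map (form κ a) (form κ b) (Coalgebra.comul c)) := by
  simp [form]

theorem alpha_one (κ : MeasuringPairing R A C) (t : M ⊗[R] C) :
    alpha κ M t 1 = TensorProduct.rid R M ((Coalgebra.counit (R := R)).lTensor M t) := by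
  induction t with
  | zero => simp
  | tmul m c => simp [form_one]
  | add x y hx hy => simp [hx, hy]

theorem alpha_mul (κ : MeasuringPairing R A C) (t : M ⊗[R] C) (a b : A) :
    alpha κ M t (a * b) = alpha κ M (alpha κ (M ⊗[R] C)
      ((TensorProduct.assoc R M C C).symm ((Coalgebra.comul (R := R)).lTensor M t)) b) a := by
  induction t with
  | zero => simp
  | tmul m c =>
    simp only [alpha_tmul, form_mul, LinearMap.lTensor_tmul]
    generalize (Coalgebra.comul (R := R) c) = w
    induction w with
    | zero => simp
    | tmul x y => simp [smul_smul, mul_comm]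
    | add x y hx hy => simp [tmul_add, add_smul, hx, hy]
  | add x y hx hy => simp [hx, hy]

end Pairings

section Rational

variable {R A C : Type u} [CommRing R] [Semiring A] [Algebra R A]
  [AddCommMonoid C] [Module R C] [Coalgebra R C]
variable {M N : Type u} [AddCommMonoid M] [Module R M] [AddCommMonoid N] [Module R N]

theorem rat_act_mem {κ : MeasuringPairing R A C} {act : A →ₐ[R] Module.End R N} {n : N}
    (hn : n ∈ rat κ act) (a : A) : act a n ∈ rat κ act := by
  obtain ⟨t, ht⟩ := mem_rat.1 hn
  refine mem_rat.2 ⟨alpha κ (N ⊗[R] C)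
      ((TensorProduct.assoc R N C C).symm ((Coalgebra.comul (R := R)).lTensor N t)) a, fun b => ?_⟩
  rw [← alpha_mul, ht, map_mul, Module.End.mul_apply]

/-- The restriction `ρ : Rat → Hom_R(A, Rat)` of `ρ_N`. -/
def ratRho (κ : MeasuringPairing R A C) (act : A →ₐ[R] Module.End R N) :
    rat κ act →ₗ[R] A →ₗ[R] rat κ act :=
  LinearMap.mk₂ R (fun n a => ⟨act a n, rat_act_mem n.2 a⟩)
    (fun _ _ _ => by ext; simp) (fun _ _ _ => by ext; simp)
    (fun _ _ _ => by ext; simp) (fun _ _ _ => by ext; simp)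

@[simp]
theorem coe_ratRho (κ : MeasuringPairing R A C) (act : A →ₐ[R] Module.End R N)
    (n : rat κ act) (a : A) : (ratRho κ act n a : N) = act a n := rfl

theorem exists_rTensor_subtype_eq {N C : Type u} [AddCommGroup N] [Module R N] [AddCommGroup C]
    [Module R C] (S : Submodule R N) (t : N ⊗[R] C) (h : S.mkQ.rTensor C t = 0) :
    ∃ s, S.subtype.rTensor C s = t :=
  (rTensor_exact C (f := S.subtype) (g := S.mkQ) (LinearMap.exact_subtype_mkQ _)
    (Submodule.mkQ_surjective _) t).1 h

theorem exists_rTensor_subtype_eq' (κ : MeasuringPairing R A C) (hκ : AlphaCondition κ)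
    (S : Submodule R N) (t : N ⊗[R] C) (h : ∀ a, alpha κ N t a ∈ S) :
    ∃ s, S.subtype.rTensor C s = t := by
  let _ : AddCommGroup N := Module.addCommMonoidToAddCommGroup R
  let _ : AddCommGroup C := Module.addCommMonoidToAddCommGroup R
  refine exists_rTensor_subtype_eq S t (hκ (N ⧸ S) (LinearMap.ext fun a => ?_))
  have h1 := alpha_natural κ S.mkQ t a
  have h2 : S.mkQ (alpha κ N t a) = 0 := by simpa using h a
  rw [h2] at h1
  rw [map_zero]
  exact h1

theorem ratRho_mem_range {κ : MeasuringPairing R A C} (hκ : AlphaCondition κ)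
    (act : A →ₐ[R] Module.End R N) (n : rat κ act) :
    ratRho κ act n ∈ LinearMap.range (alpha κ (rat κ act)) := by
  obtain ⟨t, ht⟩ := mem_rat.1 n.2
  obtain ⟨s, hs⟩ := exists_rTensor_subtype_eq' κ hκ (rat κ act) t
    fun a => by rw [ht]; exact rat_act_mem n.2 a
  refine ⟨s, ?_⟩
  ext a
  rw [coe_ratRho, ← ht, ← hs, alpha_natural]
  rfl

/-- The coaction `ϱ = α⁻¹ ∘ ρ : Rat → Rat ⊗ C` of a measuring `α`-pairing. -/
def ratCoact {κ : MeasuringPairing R A C} (hκ : AlphaCondition κ)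
    (act : A →ₐ[R] Module.End R N) : rat κ act →ₗ[R] rat κ act ⊗[R] C :=
  (LinearEquiv.ofInjective (alpha κ (rat κ act)) (hκ _)).symm.toLinearMap ∘ₗ
    (ratRho κ act).codRestrict _ (ratRho_mem_range hκ act)

@[simp]
theorem alpha_ratCoact {κ : MeasuringPairing R A C} (hκ : AlphaCondition κ)
    (act : A →ₐ[R] Module.End R N) (n : rat κ act) :
    alpha κ _ (ratCoact hκ act n) = ratRho κ act n :=
  congrArg Subtype.val ((LinearEquiv.ofInjective (alpha κ (rat κ act)) (hκ _)).apply_symm_apply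
    ((ratRho κ act).codRestrict _ (ratRho_mem_range hκ act) n))

theorem ratCoact_coassoc {κ : MeasuringPairing R A C} (hκ : AlphaCondition κ)
    (act : A →ₐ[R] Module.End R N) (n : rat κ act) :
    TensorProduct.assoc R _ _ _ ((ratCoact hκ act).rTensor C (ratCoact hκ act n)) =
      (Coalgebra.comul (R := R)).lTensor _ (ratCoact hκ act n) := by
  apply (TensorProduct.assoc R (rat κ act) C C).symm.injective
  rw [LinearEquiv.symm_apply_apply]
  refine hκ (rat κ act ⊗[R] C) (LinearMap.ext fun b => hκ (rat κ act) (LinearMap.ext fun a => ?_))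
  rw [alpha_natural, ← alpha_mul, alpha_ratCoact, alpha_ratCoact]
  exact Subtype.ext (by simp)

theorem ratCoact_counit {κ : MeasuringPairing R A C} (hκ : AlphaCondition κ)
    (act : A →ₐ[R] Module.End R N) (n : rat κ act) :
    TensorProduct.rid R _ ((Coalgebra.counit (R := R)).lTensor _ (ratCoact hκ act n)) = n := by
  rw [← alpha_one κ, alpha_ratCoact]
  exact Subtype.ext (by simp)

end Rational

section EntwiningStructures

variable {R A C : Type u} [CommRing R] [Semiring A] [Algebra R A] [AddCommMonoid C] [Module R C]

/-- For `ψ : C ⊗ A → A ⊗ C` and `a ∈ A`, the map `c ↦ ψ(c ⊗ a) = ∑ a_ψ ⊗ c^ψ`. -/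
def slice (ψ : C ⊗[R] A →ₗ[R] A ⊗[R] C) (a : A) : C →ₗ[R] A ⊗[R] C :=
  ψ ∘ₗ (TensorProduct.mk R C A).flip a

@[simp]
theorem slice_apply (ψ : C ⊗[R] A →ₗ[R] A ⊗[R] C) (a : A) (c : C) :
    slice ψ a c = ψ (c ⊗ₜ[R] a) := rfl

variable [Coalgebra R C]

/-- `(A, C, ψ)` is a right-right entwining structure. -/
structure IsEntwining (ψ : C ⊗[R] A →ₗ[R] A ⊗[R] C) : Prop where
  /-- `∑ (ab)_ψ ⊗ c^ψ = ∑ a_ψ b_Ψ ⊗ c^{ψΨ}` -/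
  map_mul : ∀ (c : C) (a b : A), ψ (c ⊗ₜ[R] (a * b)) =
    (LinearMap.mul' R A).rTensor C ((TensorProduct.assoc R A A C).symm
      ((slice ψ b).lTensor A (ψ (c ⊗ₜ[R] a))))
  /-- `∑ 1_ψ ⊗ c^ψ = 1 ⊗ c` -/
  map_one : ∀ c : C, ψ (c ⊗ₜ[R] 1) = 1 ⊗ₜ[R] c
  /-- `∑ a_ψ ⊗ Δ(c^ψ) = ∑ a_{ψΨ} ⊗ c₁^Ψ ⊗ c₂^ψ` -/
  map_comul : ∀ (c : C) (a : A),
    (Coalgebra.comul (R := R)).lTensor A (ψ (c ⊗ₜ[R] a)) =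
      TensorProduct.assoc R A C C (ψ.rTensor C ((TensorProduct.assoc R C A C).symm
        ((slice ψ a).lTensor C (Coalgebra.comul (R := R) c))))
  /-- `∑ ε(c^ψ) a_ψ = ε(c) a` -/
  map_counit : ∀ (c : C) (a : A),
    TensorProduct.rid R A ((Coalgebra.counit (R := R)).lTensor A (ψ (c ⊗ₜ[R] a))) =
      Coalgebra.counit (R := R) c • a

/-- The map `M ⊗ A → M`, `m ⊗ a ↦ m a` of a right `A`-module `M`, the latter being given as the
algebra morphism `Aᵐᵒᵖ → End_R(M)`. -/
def rightMul {M : Type u} [AddCommMonoid M] [Module R M] (act : Aᵐᵒᵖ →ₐ[R] Module.End R M) :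
    M ⊗[R] A →ₗ[R] M :=
  TensorProduct.lift (act.toLinearMap ∘ₗ (opLinearEquiv R).toLinearMap).flip

@[simp]
theorem rightMul_tmul {M : Type u} [AddCommMonoid M] [Module R M]
    (act : Aᵐᵒᵖ →ₐ[R] Module.End R M) (m : M) (a : A) :
    rightMul act (m ⊗ₜ[R] a) = act (op a) m := rfl

/-- The map `M ⊗ C → M ⊗ C`, `m ⊗ c ↦ ∑ m a_ψ ⊗ c^ψ`. -/
def entwine (ψ : C ⊗[R] A →ₗ[R] A ⊗[R] C) {M : Type u} [AddCommMonoid M] [Module R M]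
    (act : Aᵐᵒᵖ →ₐ[R] Module.End R M) (a : A) : M ⊗[R] C →ₗ[R] M ⊗[R] C :=
  (rightMul act).rTensor C ∘ₗ (TensorProduct.assoc R M A C).symm.toLinearMap ∘ₗ
    (slice ψ a).lTensor M

/-- A (right-right) entwined module over `(A, C, ψ)`: a right `A`-module (an algebra morphism
`Aᵐᵒᵖ → End_R(M)`) that is a right `C`-comodule, with `ϱ(m a) = ∑ m₀ a_ψ ⊗ m₁^ψ`. -/
structure EntwinedModule (ψ : C ⊗[R] A →ₗ[R] A ⊗[R] C) where
  carrier : Type u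
  [addCommMonoid : AddCommMonoid carrier]
  [module : Module R carrier]
  act : Aᵐᵒᵖ →ₐ[R] Module.End R carrier
  coact : carrier →ₗ[R] carrier ⊗[R] C
  coassoc : ∀ m, TensorProduct.assoc R carrier C C (coact.rTensor C (coact m)) =
    (Coalgebra.comul (R := R)).lTensor carrier (coact m)
  counit : ∀ m,
    TensorProduct.rid R carrier ((Coalgebra.counit (R := R)).lTensor carrier (coact m)) = m
  coact_act : ∀ m a, coact (act (op a) m) = entwine ψ act a (coact m)

attribute [instance] EntwinedModule.addCommMonoid EntwinedModule.module

variable {ψ : C ⊗[R] A →ₗ[R] A ⊗[R] C}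

/-- `A`-linear `C`-colinear maps. -/
@[ext]
structure EntwinedModule.Hom (M N : EntwinedModule ψ) where
  toLinearMap : M.carrier →ₗ[R] N.carrier
  map_act : ∀ a m, toLinearMap (M.act (op a) m) = N.act (op a) (toLinearMap m)
  map_coact : ∀ m, N.coact (toLinearMap m) = toLinearMap.rTensor C (M.coact m)

/-- The category `M_A^C(ψ)`. -/
instance : Category (EntwinedModule ψ) where
  Hom := EntwinedModule.Hom
  id M := ⟨LinearMap.id, fun _ _ => rfl, fun m => by simp⟩
  comp f g := ⟨g.toLinearMap ∘ₗ f.toLinearMap, fun a m => by simp [f.map_act, g.map_act],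
    fun m => by simp [f.map_coact, g.map_coact, LinearMap.rTensor_comp]⟩

theorem alpha_entwine {A' : Type u} [Semiring A'] [Algebra R A'] (κ : MeasuringPairing R A' C)
    {M : Type u} [AddCommMonoid M] [Module R M] (act : Aᵐᵒᵖ →ₐ[R] Module.End R M)
    (a : A) (m : M) (c : C) (g : A') :
    alpha κ M (entwine ψ act a (m ⊗ₜ[R] c)) g = act (op (alpha κ A (ψ (c ⊗ₜ[R] a)) g)) m := by
  simp only [entwine, LinearMap.comp_apply, LinearMap.lTensor_tmul, slice_apply,
    LinearEquiv.coe_coe]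
  generalize ψ (c ⊗ₜ[R] a) = w
  induction w with
  | zero => simp
  | tmul x y => simp
  | add x y hx hy => simp only [tmul_add, map_add, LinearMap.add_apply, hx, hy, MulOpposite.op_add]

/-- The left `A'`-module structure `g m = ∑ m₀ ⟨g, m₁⟩` that a `C`-comodule carries for a measuring
pairing `(A', C)`. -/
def EntwinedModule.leftAct {A' : Type u} [Semiring A'] [Algebra R A'] (M : EntwinedModule ψ)
    (κ : MeasuringPairing R A' C) : A' →ₐ[R] Module.End R M.carrier :=
  AlgHom.ofLinearMap ((alpha κ M.carrier ∘ₗ M.coact).flip)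
    (by ext m; simp [alpha_one, M.counit])
    (fun a b => by
      ext m
      simp only [LinearMap.flip_apply, LinearMap.comp_apply, Module.End.mul_apply]
      rw [alpha_mul, ← M.coassoc, LinearEquiv.symm_apply_apply, alpha_natural])

theorem EntwinedModule.leftAct_apply {A' : Type u} [Semiring A'] [Algebra R A']
    (M : EntwinedModule ψ) (κ : MeasuringPairing R A' C) (g : A') (m : M.carrier) :
    M.leftAct κ g m = alpha κ M.carrier (M.coact m) g := rfl

end EntwiningStructures

section DualModules

variable {R : Type u} [CommRing R]

/-- The left `A`-module structure `(a h)(m) = h(m a)` on the dual of a right `A`-module. -/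
def dualLeft {A M : Type u} [Semiring A] [Algebra R A] [AddCommMonoid M] [Module R M]
    (act : Aᵐᵒᵖ →ₐ[R] Module.End R M) : A →ₐ[R] Module.End R (Module.Dual R M) :=
  AlgHom.ofLinearMap
    (Module.Dual.transpose ∘ₗ act.toLinearMap ∘ₗ (opLinearEquiv R).toLinearMap)
    (by ext; simp [Module.Dual.transpose_apply])
    (fun a b => by ext; simp [Module.Dual.transpose_apply])

@[simp]
theorem dualLeft_apply {A M : Type u} [Semiring A] [Algebra R A] [AddCommMonoid M] [Module R M]
    (act : Aᵐᵒᵖ →ₐ[R] Module.End R M) (a : A) (h : Module.Dual R M) (m : M) :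
    dualLeft act a h m = h (act (op a) m) := rfl

/-- The right `A`-module structure `(h a)(m) = h(a m)` on the dual of a left `A`-module. -/
def dualRight {A M : Type u} [Semiring A] [Algebra R A] [AddCommMonoid M] [Module R M]
    (act : A →ₐ[R] Module.End R M) : Aᵐᵒᵖ →ₐ[R] Module.End R (Module.Dual R M) :=
  AlgHom.ofLinearMap
    (Module.Dual.transpose ∘ₗ act.toLinearMap ∘ₗ (opLinearEquiv R).symm.toLinearMap)
    (by ext; simp [Module.Dual.transpose_apply])
    (fun a b => by ext; simp [Module.Dual.transpose_apply])

@[simp]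
theorem dualRight_apply {A M : Type u} [Semiring A] [Algebra R A] [AddCommMonoid M] [Module R M]
    (act : A →ₐ[R] Module.End R M) (a : A) (h : Module.Dual R M) (m : M) :
    dualRight act (op a) h m = h (act a m) := rfl

variable {A C A' C' : Type u} [Semiring A] [Algebra R A] [AddCommMonoid C] [Module R C] [Coalgebra R C]
  [Semiring A'] [Algebra R A'] [AddCommMonoid C'] [Module R C'] [Coalgebra R C']

/-- `ψ` and `φ` are adjoint for measuring pairings `(A, C')` and `(A', C)`:
`∑ ⟨a_ψ, d⟩ ⟨g, c^ψ⟩ = ∑ ⟨g_φ, c⟩ ⟨a, d^φ⟩`. -/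
def AreDual (κ : MeasuringPairing R A C') (κ' : MeasuringPairing R A' C)
    (ψ : C ⊗[R] A →ₗ[R] A ⊗[R] C) (φ : C' ⊗[R] A' →ₗ[R] A' ⊗[R] C') : Prop :=
  ∀ (c : C) (a : A) (d : C') (g : A'),
    form κ (alpha κ' A (ψ (c ⊗ₜ[R] a)) g) d = form κ' (alpha κ A' (φ (d ⊗ₜ[R] g)) a) c

variable {κ : MeasuringPairing R A C'} {κ' : MeasuringPairing R A' C}
  {ψ : C ⊗[R] A →ₗ[R] A ⊗[R] C} {φ : C' ⊗[R] A' →ₗ[R] A' ⊗[R] C'}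

theorem AreDual.symm (h : AreDual κ κ' ψ φ) : AreDual κ' κ φ ψ :=
  fun c a d g => (h d g c a).symm

variable (M : EntwinedModule ψ)

theorem AreDual.entwine_eq (h : AreDual κ κ' ψ φ) (x : Module.Dual R M.carrier)
    (t : Module.Dual R M.carrier ⊗[R] C')
    (ht : ∀ a, alpha κ _ t a = dualLeft M.act a x) (g : A') (a : A) :
    alpha κ _ (entwine φ (dualRight (M.leftAct κ')) g t) a =
      dualLeft M.act a (dualRight (M.leftAct κ') (op g) x) := by
  ext m
  simp only [dualLeft_apply, dualRight_apply, EntwinedModule.leftAct_apply, M.coact_act]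
  obtain ⟨S, rfl⟩ := TensorProduct.exists_finset t
  have hL : alpha κ _ (entwine φ (dualRight (M.leftAct κ')) g (∑ i ∈ S, i.1 ⊗ₜ[R] i.2)) a m =
      ∑ i ∈ S, i.1 (alpha κ' _ (M.coact m) (alpha κ A' (φ (i.2 ⊗ₜ[R] g)) a)) := by
    simp only [map_sum, LinearMap.sum_apply, alpha_entwine, dualRight_apply,
      EntwinedModule.leftAct_apply]
  rw [hL]
  generalize M.coact m = u
  induction u with
  | zero => simp
  | add u v hu hv => simp only [map_add, LinearMap.add_apply, Finset.sum_add_distrib, hu, hv]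
  | tmul m c =>
    rw [alpha_entwine]
    have := LinearMap.congr_fun (ht (alpha κ' A (ψ (c ⊗ₜ[R] a)) g)) m
    rw [dualLeft_apply] at this
    rw [← this]
    simp [h c a]

/-- The rational part `Rat^{C'}(_A M*)` of the dual of an entwined module. -/
abbrev EntwinedModule.ratDual (κ : MeasuringPairing R A C') :
    Submodule R (Module.Dual R M.carrier) :=
  rat κ (dualLeft M.act)

theorem AreDual.act_mem (h : AreDual κ κ' ψ φ) (g : A') {x : Module.Dual R M.carrier}
    (hx : x ∈ M.ratDual κ) : dualRight (M.leftAct κ') (op g) x ∈ M.ratDual κ := by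
  obtain ⟨t, ht⟩ := mem_rat.1 hx
  exact mem_rat.2 ⟨_, h.entwine_eq M x t ht g⟩

/-- The right `A'`-module structure of `Rat^{C'}(_A M*)`, restricted from `M*`. -/
def ratDualAct (h : AreDual κ κ' ψ φ) : A'ᵐᵒᵖ →ₐ[R] Module.End R (M.ratDual κ) :=
  AlgHom.ofLinearMap
    (LinearMap.mk₂ R (fun g x => ⟨dualRight (M.leftAct κ') g x, h.act_mem M (unop g) x.2⟩)
      (fun _ _ _ => by ext1; simp) (fun _ _ _ => by ext1; simp)
      (fun _ _ _ => by ext1; simp) (fun _ _ _ => by ext1; simp))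
    (by ext1 x; ext1; simp) (fun a b => by ext1 x; ext1; simp)

@[simp]
theorem coe_ratDualAct (h : AreDual κ κ' ψ φ) (g : A'ᵐᵒᵖ) (x : M.ratDual κ) :
    (ratDualAct M h g x : Module.Dual R M.carrier) = dualRight (M.leftAct κ') g x := rfl

theorem coe_alpha_entwine (h : AreDual κ κ' ψ φ) (s : M.ratDual κ ⊗[R] C') (g : A') (a : A) :
    (alpha κ (M.ratDual κ) (entwine φ (M := M.ratDual κ) (ratDualAct M h) g s) a : Module.Dual R M.carrier) =
      alpha κ _ (entwine φ (dualRight (M.leftAct κ')) g ((M.ratDual κ).subtype.rTensor C' s)) a := by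
  induction s with
  | zero => simp only [map_zero, LinearMap.zero_apply, Submodule.coe_zero]
  | add s t hs ht => simp only [map_add, LinearMap.add_apply, Submodule.coe_add, hs, ht]
  | tmul y d => rw [LinearMap.rTensor_tmul, alpha_entwine, alpha_entwine, coe_ratDualAct]; rfl

theorem ratCoact_ratDualAct (hκ : AlphaCondition κ) (h : AreDual κ κ' ψ φ) (x : M.ratDual κ)
    (g : A') : ratCoact hκ (dualLeft M.act) (ratDualAct M h (op g) x) =
      entwine φ (M := M.ratDual κ) (ratDualAct M h) g (ratCoact hκ (dualLeft M.act) x) := by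
  refine hκ (M.ratDual κ) ?_
  refine LinearMap.ext fun a => Subtype.ext ?_
  rw [coe_alpha_entwine, h.entwine_eq M x _ (fun a => ?_) g a, alpha_ratCoact, coe_ratRho,
    coe_ratDualAct]
  rw [alpha_natural, alpha_ratCoact]
  rfl

/-- The dual entwined module `Rat^{C'}(_A M*)` over `(A', C', φ)`. -/
def dualEntwined (hκ : AlphaCondition κ) (h : AreDual κ κ' ψ φ) : EntwinedModule φ where
  carrier := M.ratDual κ
  act := ratDualAct M h
  coact := ratCoact hκ (dualLeft M.act)
  coassoc := ratCoact_coassoc hκ (dualLeft M.act)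
  counit := ratCoact_counit hκ (dualLeft M.act)
  coact_act x g := ratCoact_ratDualAct M hκ h x g

variable {M} {N : EntwinedModule ψ}

theorem dual_mem_rat (f : M ⟶ N) {x : Module.Dual R N.carrier} (hx : x ∈ N.ratDual κ) :
    x ∘ₗ f.toLinearMap ∈ M.ratDual κ := by
  obtain ⟨t, ht⟩ := mem_rat.1 hx
  refine mem_rat.2 ⟨(Module.Dual.transpose (R := R) f.toLinearMap).rTensor C' t, fun a => ?_⟩
  rw [alpha_natural, ht]
  ext m
  simp [Module.Dual.transpose_apply, f.map_act]

/-- The restriction of `f*` to the rational parts. -/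
def ratDualMap (κ : MeasuringPairing R A C') (f : M ⟶ N) : N.ratDual κ →ₗ[R] M.ratDual κ :=
  (Module.Dual.transpose (R := R) f.toLinearMap).restrict fun _ hx => dual_mem_rat f hx

@[simp]
theorem coe_ratDualMap (f : M ⟶ N) (x : N.ratDual κ) :
    (ratDualMap κ f x : Module.Dual R M.carrier) = (x : Module.Dual R N.carrier) ∘ₗ f.toLinearMap :=
  rfl

theorem ratDualMap_act (h : AreDual κ κ' ψ φ) (f : M ⟶ N) (g : A') (x : N.ratDual κ) :
    ratDualMap κ f (ratDualAct N h (op g) x) = ratDualAct M h (op g) (ratDualMap κ f x) := by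
  refine Subtype.ext (LinearMap.ext fun m => ?_)
  simp [EntwinedModule.leftAct_apply, f.map_coact, alpha_natural]

theorem ratDualMap_coact (hκ : AlphaCondition κ) (f : M ⟶ N) (x : N.ratDual κ) :
    ratCoact hκ (dualLeft M.act) (ratDualMap κ f x) =
      (ratDualMap κ f).rTensor C' (ratCoact hκ (dualLeft N.act) x) := by
  refine hκ (M.ratDual κ) ?_
  refine LinearMap.ext fun a => Subtype.ext (LinearMap.ext fun m => ?_)
  rw [alpha_natural, alpha_ratCoact, alpha_ratCoact]
  simp [f.map_act]

/-- The contravariant functor `M ↦ Rat^{C'}(_A M*)`, `f ↦ f*`. -/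
def dualFunctor (hκ : AlphaCondition κ) (h : AreDual κ κ' ψ φ) :
    (EntwinedModule ψ)ᵒᵖ ⥤ EntwinedModule φ where
  obj M := dualEntwined M.unop hκ h
  map f :=
    { toLinearMap := ratDualMap κ f.unop
      map_act := ratDualMap_act h f.unop
      map_coact := ratDualMap_coact hκ f.unop }
  map_id _ := rfl
  map_comp _ _ := rfl

end DualModules

section FiniteDual

/-- An `R`-linear map `K → M` (in practice an inclusion) is pure, in the sense of Cohn, if
`K ⊗ N → M ⊗ N` is injective for every `R`-module `N`. -/
def IsPure {R K M : Type u} [CommRing R] [AddCommMonoid K] [Module R K] [AddCommMonoid M]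
    [Module R M] (f : K →ₗ[R] M) : Prop :=
  ∀ (N : Type u) [AddCommMonoid N] [Module R N], Function.Injective (f.rTensor N)

theorem eq_zero_of_proj_eq_zero {R X M : Type u} [CommRing R] [IsNoetherianRing R]
    [AddCommMonoid M] [Module R M] (t : M ⊗[R] (X → R))
    (h : ∀ a, TensorProduct.rid R M ((LinearMap.proj a : (X → R) →ₗ[R] R).lTensor M t) = 0) :
    t = 0 := by
  obtain ⟨S, rfl⟩ := TensorProduct.exists_finset t
  let π : (S → R) →ₗ[R] M := Fintype.linearCombination R fun i : S => i.1.1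
  obtain ⟨n, k, hk⟩ := Submodule.fg_iff_exists_fin_generating_family.1
    (IsNoetherian.noetherian (LinearMap.ker π))
  have hmem : ∀ a, (fun i : S => i.1.2 a) ∈ Submodule.span R (Set.range k) := by
    intro a
    rw [hk, LinearMap.mem_ker, Fintype.linearCombination_apply, ← h a]
    simp only [map_sum, LinearMap.lTensor_tmul, TensorProduct.rid_tmul, LinearMap.proj_apply]
    exact Finset.sum_coe_sort S fun i => i.2 a • i.1
  choose g hg using fun a => (Submodule.mem_span_range_iff_exists_fun R).1 (hmem a)
  have hk0 : ∀ j, ∑ i : S, k j i • i.1.1 = 0 := fun j => by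
    have : k j ∈ LinearMap.ker π := hk ▸ Submodule.subset_span ⟨j, rfl⟩
    simpa [π, Fintype.linearCombination_apply] using this
  have hf : ∀ i : S, i.1.2 = ∑ j, k j i • fun a => g a j := by
    intro i
    ext a
    have := congrFun (hg a) i
    simp only [Finset.sum_apply, Pi.smul_apply, smul_eq_mul] at this ⊢
    rw [← this]
    exact Finset.sum_congr rfl fun _ _ => mul_comm _ _
  rw [← Finset.sum_coe_sort S fun i => i.1 ⊗ₜ[R] i.2]
  calc ∑ i : S, i.1.1 ⊗ₜ[R] i.1.2
      = ∑ i : S, ∑ j, (k j i • i.1.1) ⊗ₜ[R] (fun a => g a j) := by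
        refine Finset.sum_congr rfl fun i _ => ?_
        conv_lhs => rw [hf i]
        simp [tmul_sum, smul_tmul]
    _ = ∑ j, (∑ i : S, k j i • i.1.1) ⊗ₜ[R] (fun a => g a j) := by
        rw [Finset.sum_comm]
        simp [sum_tmul]
    _ = 0 := Finset.sum_eq_zero fun j _ => by rw [hk0, zero_tmul]

variable (R A : Type u) [CommRing R] [IsNoetherianRing R] [Ring A] [Algebra R A]

variable {A} in
/-- The `R`-module `AfA ⊆ A*`, spanned by the functionals `a f b : x ↦ f(b x a)`. -/
def orbitSpan (f : Module.Dual R A) : Submodule R (Module.Dual R A) :=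
  Submodule.span R (Set.range fun p : A × A => f ∘ₗ LinearMap.mulLeftRight R p)

/-- The finite dual `A° = {f ∈ A* | AfA is finitely generated over R}`. -/
def finiteDual : Submodule R (Module.Dual R A) where
  carrier := {f | (orbitSpan R f).FG}
  zero_mem' := by
    have : orbitSpan R (0 : Module.Dual R A) = ⊥ := by
      rw [orbitSpan, Submodule.span_eq_bot]
      rintro _ ⟨p, rfl⟩
      simp
    change (orbitSpan R (0 : Module.Dual R A)).FG
    rw [this]
    exact Submodule.fg_bot
  add_mem' {f g} hf hg := by
    refine Submodule.FG.of_le (hf.sup hg) (Submodule.span_le.2 ?_)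
    rintro _ ⟨p, rfl⟩
    beta_reduce
    rw [LinearMap.add_comp]
    exact Submodule.add_mem_sup (Submodule.subset_span (Set.mem_range_self p))
      (Submodule.subset_span (Set.mem_range_self p))
  smul_mem' r f hf := by
    refine Submodule.FG.of_le hf (Submodule.span_le.2 ?_)
    rintro _ ⟨p, rfl⟩
    exact Submodule.smul_mem _ r (Submodule.subset_span (Set.mem_range_self p))

/-- `A` is an `α`-algebra: `A° ⊆ R^A` is a pure `R`-submodule. -/
class IsAlphaAlgebra : Prop where
  pure : IsPure (LinearMap.ltoFun R A R R ∘ₗ (finiteDual R A).subtype)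

/-- An `R`-subcoalgebra of `A°`: a pure `R`-submodule `D ⊆ A°` with `Δ(D) ⊆ D ⊗ D`. The
comultiplication of `A°` is dual to the multiplication of `A`: under `A° ⊗ A° ⊆ (A ⊗ A)*`
the element `Δ(f)` is the functional `a ⊗ b ↦ f(ab)`. -/
structure FiniteDualSubcoalgebra extends Submodule R (Module.Dual R A) where
  le_finiteDual : toSubmodule ≤ finiteDual R A
  pure : IsPure (Submodule.inclusion le_finiteDual)
  exists_comul : ∀ f ∈ toSubmodule, ∃ t : toSubmodule ⊗[R] toSubmodule,
    TensorProduct.dualDistrib R A A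
      (TensorProduct.map toSubmodule.subtype toSubmodule.subtype t) = f ∘ₗ LinearMap.mul' R A

variable {R A}

namespace FiniteDualSubcoalgebra

variable (D : FiniteDualSubcoalgebra R A)

/-- Evaluation `f ↦ f(a)` on `D`. -/
def eval : A →ₗ[R] D.toSubmodule →ₗ[R] R :=
  (LinearMap.id : Module.Dual R A →ₗ[R] Module.Dual R A).domRestrict D.toSubmodule |>.flip

@[simp]
theorem eval_apply (a : A) (f : D.toSubmodule) : D.eval a f = (f : Module.Dual R A) a := rfl

/-- The map `m ⊗ f ↦ f(a) m`. -/
def contract (M : Type u) [AddCommMonoid M] [Module R M] (a : A) :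
    M ⊗[R] D.toSubmodule →ₗ[R] M :=
  (TensorProduct.rid R M).toLinearMap ∘ₗ (D.eval a).lTensor M

@[simp]
theorem contract_tmul {M : Type u} [AddCommMonoid M] [Module R M] (a : A) (m : M)
    (f : D.toSubmodule) : D.contract M a (m ⊗ₜ[R] f) = (f : Module.Dual R A) a • m := by
  simp [contract]

theorem contract_natural {M N : Type u} [AddCommMonoid M] [Module R M] [AddCommMonoid N]
    [Module R N] (f : M →ₗ[R] N) (t : M ⊗[R] D.toSubmodule) (a : A) :
    D.contract N a (f.rTensor _ t) = f (D.contract M a t) := by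
  induction t with
  | zero => simp
  | tmul m c => simp
  | add x y hx hy => simp [hx, hy]

theorem ext_contract [IsAlphaAlgebra R A] {M : Type u} [AddCommMonoid M] [Module R M]
    {s t : M ⊗[R] D.toSubmodule} (h : ∀ a, D.contract M a s = D.contract M a t) : s = t := by
  let _ : AddCommGroup M := Module.addCommMonoidToAddCommGroup R
  let ι : D.toSubmodule →ₗ[R] (A → R) := LinearMap.ltoFun R A R R ∘ₗ D.toSubmodule.subtype
  have hι : Function.Injective (ι.lTensor M) := by
    have h1 : ι = (LinearMap.ltoFun R A R R ∘ₗ (finiteDual R A).subtype) ∘ₗ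
        Submodule.inclusion D.le_finiteDual := rfl
    have h2 : Function.Injective (ι.rTensor M) := by
      rw [h1, LinearMap.rTensor_comp]
      exact (IsAlphaAlgebra.pure M).comp (D.pure M)
    have h3 : ι.lTensor M = (TensorProduct.comm R _ _).toLinearMap ∘ₗ ι.rTensor M ∘ₗ
        (TensorProduct.comm R _ _).toLinearMap := by ext; simp
    rw [h3]
    exact (TensorProduct.comm R _ _).injective.comp
      (h2.comp (TensorProduct.comm R _ _).injective)
  have hι' : ∀ (a : A) (w : M ⊗[R] D.toSubmodule),
      TensorProduct.rid R M ((LinearMap.proj a : (A → R) →ₗ[R] R).lTensor M (ι.lTensor M w)) =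
        D.contract M a w := by
    intro a w
    rw [← LinearMap.comp_apply, ← LinearMap.lTensor_comp]
    rfl
  apply hι
  rw [← sub_eq_zero, ← map_sub]
  refine eq_zero_of_proj_eq_zero _ fun a => ?_
  rw [hι', map_sub, h, sub_self]

/-- The canonical map `D ⊗ D → (A ⊗ A)*`. -/
def distrib : D.toSubmodule ⊗[R] D.toSubmodule →ₗ[R] Module.Dual R (A ⊗[R] A) :=
  TensorProduct.dualDistrib R A A ∘ₗ TensorProduct.map D.toSubmodule.subtype D.toSubmodule.subtype

theorem distrib_apply (t : D.toSubmodule ⊗[R] D.toSubmodule) (a b : A) :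
    D.distrib t (a ⊗ₜ[R] b) = (D.contract D.toSubmodule b t : Module.Dual R A) a := by
  induction t with
  | zero => simp
  | tmul m c => simp [distrib, mul_comm]
  | add x y hx hy => simp [hx, hy]

theorem distrib_injective [IsAlphaAlgebra R A] : Function.Injective D.distrib := by
  intro s t h
  refine D.ext_contract fun b => Subtype.ext (LinearMap.ext fun a => ?_)
  rw [← distrib_apply, h, distrib_apply]

/-- The comultiplication of `D`, with `Δ(f)` the unique element of `D ⊗ D` that represents
`a ⊗ b ↦ f(ab)`. -/
def comul [IsAlphaAlgebra R A] : D.toSubmodule →ₗ[R] D.toSubmodule ⊗[R] D.toSubmodule :=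
  (LinearEquiv.ofInjective D.distrib D.distrib_injective).symm.toLinearMap ∘ₗ
    ((LinearMap.lcomp R R (LinearMap.mul' R A)) ∘ₗ D.toSubmodule.subtype).codRestrict _
      fun f => D.exists_comul f f.2

theorem distrib_comul [IsAlphaAlgebra R A] (f : D.toSubmodule) :
    D.distrib (D.comul f) = (f : Module.Dual R A) ∘ₗ LinearMap.mul' R A :=
  congrArg Subtype.val ((LinearEquiv.ofInjective D.distrib D.distrib_injective).apply_symm_apply _)

theorem contract_comul [IsAlphaAlgebra R A] (f : D.toSubmodule) (a b : A) :
    (D.contract D.toSubmodule b (D.comul f) : Module.Dual R A) a = (f : Module.Dual R A) (a * b) := by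
  rw [← distrib_apply, distrib_comul]
  simp

theorem contract_lTensor_comul [IsAlphaAlgebra R A] {M : Type u} [AddCommMonoid M] [Module R M]
    (t : M ⊗[R] D.toSubmodule) (b c : A) :
    D.contract M b (D.contract (M ⊗[R] D.toSubmodule) c
      ((TensorProduct.assoc R M _ _).symm (D.comul.lTensor M t))) = D.contract M (b * c) t := by
  induction t with
  | zero => simp
  | add x y hx hy => simp [hx, hy]
  | tmul m f =>
    rw [LinearMap.lTensor_tmul, contract_tmul, ← contract_comul]
    generalize D.comul f = w
    induction w with
    | zero => simp
    | add x y hx hy => simp [tmul_add, add_smul, hx, hy]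
    | tmul x y => simp [smul_smul]

/-- The coalgebra structure of a subcoalgebra of `A°`; the counit is `f ↦ f(1)`. -/
instance [IsAlphaAlgebra R A] : Coalgebra R D.toSubmodule where
  comul := D.comul
  counit := D.eval 1
  coassoc := by
    refine LinearMap.ext fun f => (TensorProduct.assoc R _ _ _).symm.injective ?_
    refine D.ext_contract fun c => D.ext_contract fun b => Subtype.ext (LinearMap.ext fun a => ?_)
    simp only [LinearMap.comp_apply, LinearEquiv.coe_coe, LinearEquiv.symm_apply_apply]
    rw [contract_lTensor_comul, contract_natural, contract_comul, contract_comul, contract_comul,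
      mul_assoc]
  rTensor_counit_comp_comul := by
    refine LinearMap.ext fun f => D.ext_contract fun b => ?_
    rw [LinearMap.comp_apply, contract_natural, eval_apply, contract_comul]
    simp
  lTensor_counit_comp_comul := by
    refine LinearMap.ext fun f => (TensorProduct.rid R _).injective ?_
    refine Subtype.ext (LinearMap.ext fun a => ?_)
    have := D.contract_comul f a 1
    rw [mul_one] at this
    simpa [contract] using this

/-- The measuring pairing `(A, D)`, `⟨a, f⟩ = f(a)`. -/
def pairing [IsAlphaAlgebra R A] : MeasuringPairing R A D.toSubmodule :=
  AlgHom.ofLinearMap ((WithConv.linearEquiv R _).symm.toLinearMap ∘ₗ D.eval)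
    (by ext f; simp; rfl)
    (fun a b => by
      ext f
      have h := D.contract_comul f a b
      rw [← distrib_apply] at h
      simp only [LinearMap.convMul_apply]
      refine h.symm.trans ?_
      change D.distrib (D.comul f) (a ⊗ₜ[R] b) =
        LinearMap.mul' R R (TensorProduct.map (D.eval a) (D.eval b) (D.comul f))
      generalize D.comul f = w
      induction w with
      | zero => simp
      | add x y hx hy => simp [hx, hy]
      | tmul x y => simp [distrib])

theorem form_pairing [IsAlphaAlgebra R A] (a : A) (f : D.toSubmodule) :
    form D.pairing a f = (f : Module.Dual R A) a := rfl

theorem alphaCondition [IsAlphaAlgebra R A] : AlphaCondition D.pairing := by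
  intro M _ _ s t h
  have key : ∀ (w : M ⊗[R] D.toSubmodule) (a : A), alpha D.pairing M w a = D.contract M a w := by
    intro w a
    induction w with
    | zero => simp
    | add x y hx hy => simp [hx, hy]
    | tmul x y => simp [form_pairing]
  exact D.ext_contract fun a => by rw [← key, ← key, h]

end FiniteDualSubcoalgebra

end FiniteDual

section DualEntwining

variable {R A C : Type u} [CommRing R] [IsNoetherianRing R] [Ring A] [Algebra R A]
  [IsAlphaAlgebra R A] [AddCommGroup C] [Module R C] [Coalgebra R C]

/-- For a subalgebra `B ⊆ C*` and a subcoalgebra `D ⊆ A°`, the map `φ : D ⊗ B → B ⊗ D` is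
the restriction of `ψ* : (A ⊗ C)* → (C ⊗ A)*` along the canonical maps `D ⊗ B → (A ⊗ C)*` and
`B ⊗ D → (C ⊗ A)*`. -/
def IsDualMap (ψ : C ⊗[R] A →ₗ[R] A ⊗[R] C) (B : Subalgebra R (WithConv (C →ₗ[R] R)))
    (D : FiniteDualSubcoalgebra R A)
    (φ : D.toSubmodule ⊗[R] B →ₗ[R] B ⊗[R] D.toSubmodule) : Prop :=
  ∀ t : D.toSubmodule ⊗[R] B,
    TensorProduct.dualDistrib R C A
      (TensorProduct.map (form B.val) D.toSubmodule.subtype (φ t)) =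
    TensorProduct.dualDistrib R A C
      (TensorProduct.map D.toSubmodule.subtype (form B.val) t) ∘ₗ ψ

variable {ψ : C ⊗[R] A →ₗ[R] A ⊗[R] C} {B : Subalgebra R (WithConv (C →ₗ[R] R))}
  {D : FiniteDualSubcoalgebra R A} {φ : D.toSubmodule ⊗[R] B →ₗ[R] B ⊗[R] D.toSubmodule}

theorem IsDualMap.areDual (h : IsDualMap ψ B D φ) : AreDual D.pairing B.val ψ φ := by
  intro c a d g
  have h1 := LinearMap.congr_fun (h (d ⊗ₜ[R] g)) (c ⊗ₜ[R] a)
  have hL : ∀ w : B ⊗[R] D.toSubmodule, TensorProduct.dualDistrib R C A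
      (TensorProduct.map (form B.val) D.toSubmodule.subtype w) (c ⊗ₜ[R] a) =
        form B.val (alpha D.pairing B w a) c := by
    intro w
    induction w with
    | zero => simp
    | add x y hx hy => simp only [map_add, LinearMap.add_apply, hx, hy]
    | tmul x y => simp [FiniteDualSubcoalgebra.form_pairing, mul_comm]
  have hR : ∀ w : A ⊗[R] C, TensorProduct.dualDistrib R A C
      (TensorProduct.map D.toSubmodule.subtype (form B.val) (d ⊗ₜ[R] g)) w =
        form D.pairing (alpha B.val A w g) d := by
    intro w
    induction w with
    | zero => simp
    | add x y hx hy => simp only [map_add, LinearMap.add_apply, hx, hy]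
    | tmul x y => simp [FiniteDualSubcoalgebra.form_pairing, mul_comm]
  rw [hL, LinearMap.comp_apply, hR] at h1
  exact h1.symm

/-- The contravariant functor `M ↦ M_r = Rat^D(_A M*)` from `M_A^C(ψ)` to `M_B^D(φ)`. -/
def lowerR (h : IsDualMap ψ B D φ) : (EntwinedModule ψ)ᵒᵖ ⥤ EntwinedModule φ :=
  dualFunctor D.alphaCondition h.areDual

/-- The contravariant functor `K ↦ K^r = Rat^C(_B K*)` from `M_B^D(φ)` to `M_A^C(ψ)`. -/
def upperR (h : IsDualMap ψ B D φ) (hα : AlphaCondition B.val) :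
    (EntwinedModule φ)ᵒᵖ ⥤ EntwinedModule ψ :=
  dualFunctor hα h.areDual.symm

end DualEntwining

end Entwined

end

/-!
Let `(A, C')` and `(A', C)` be measuring `α`-pairings for which `ψ` and `φ` are adjoint, with
`A' ⊆ C*`. By the `α`-condition the functionals `⟨a, -⟩` on `C'` separate the elements of `A' ⊗ C'`,
and `C` separates those of `A'`, so an identity in `A' ⊗ C'` may be tested against all `a ∈ A` and
`c ∈ C`. Tested in this way, each axiom of an entwining structure for `φ` is the dual axiom for `ψ`:
multiplicativity and comultiplicativity exchange their roles, and so do unit and counit.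

For the adjunction, a morphism `M ⟶ Rat(K*)` is the same as a bilinear form on `M × K` for which the
actions of `A` and of `A'` on the two arguments are adjoint; colinearity is linearity over the
pairing algebra by the `α`-condition, and rationality of the functionals is then automatic. This
description is symmetric in `M` and `K`.
-/

namespace Entwined

noncomputable section

variable {R A C A' C' : Type u} [CommRing R] [Semiring A] [Algebra R A] [AddCommMonoid C]
  [Module R C] [Coalgebra R C] [Semiring A'] [Algebra R A'] [AddCommMonoid C'] [Module R C']
  [Coalgebra R C'] {κ : MeasuringPairing R A C'} {κ' : MeasuringPairing R A' C}
  {ψ : C ⊗[R] A →ₗ[R] A ⊗[R] C} {φ : C' ⊗[R] A' →ₗ[R] A' ⊗[R] C'}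

theorem form_injective (hκ : Function.Injective κ) : Function.Injective (form κ) :=
  (WithConv.linearEquiv R (C' →ₗ[R] R)).injective.comp hκ

theorem form_mul_eq_sum (κ : MeasuringPairing R A C') {d : C'} {ι : Type*}
    (𝓓 : Coalgebra.Repr R d ι) (a b : A) :
    form κ (a * b) d = ∑ i ∈ 𝓓.index, form κ a (𝓓.left i) * form κ b (𝓓.right i) := by
  simp only [form_mul, ← 𝓓.eq, map_sum, map_tmul, LinearMap.mul'_apply]

theorem ext_form_alpha (hκ : AlphaCondition κ) (hκ' : Function.Injective κ') {s t : A' ⊗[R] C'}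
    (hst : ∀ a c, form κ' (alpha κ A' s a) c = form κ' (alpha κ A' t a) c) : s = t :=
  hκ A' (LinearMap.ext fun a => form_injective hκ' (LinearMap.ext (hst a)))

theorem alpha_rTensor_mul'_slice (κ' : MeasuringPairing R A' C) (ψ : C ⊗[R] A →ₗ[R] A ⊗[R] C)
    (x : A) (c : C) (b : A) (g : A') :
    alpha κ' A ((LinearMap.mul' R A).rTensor C ((TensorProduct.assoc R A A C).symm
      ((slice ψ b).lTensor A (x ⊗ₜ[R] c)))) g = x * alpha κ' A (ψ (c ⊗ₜ[R] b)) g := by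
  have rightMul_lsmul : rightMul (Algebra.lsmul R R A) = LinearMap.mul' R A := by ext; simp
  simpa [entwine, rightMul_lsmul] using alpha_entwine κ' (ψ := ψ) (Algebra.lsmul R R A) b x c g

theorem alpha_alpha_rTensor_slice (κ' : MeasuringPairing R A' C) (ψ : C ⊗[R] A →ₗ[R] A ⊗[R] C)
    (a : A) (c₁ c₂ : C) (g g' : A') :
    alpha κ' A (alpha κ' (A ⊗[R] C) (ψ.rTensor C ((TensorProduct.assoc R C A C).symm
      ((slice ψ a).lTensor C (c₁ ⊗ₜ[R] c₂)))) g') g =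
        alpha κ' A (ψ (c₁ ⊗ₜ[R] alpha κ' A (ψ (c₂ ⊗ₜ[R] a)) g')) g := by
  have alpha_assoc_symm (w : A ⊗[R] C) :
      alpha κ' (C ⊗[R] A) ((TensorProduct.assoc R C A C).symm (c₁ ⊗ₜ[R] w)) g' =
        c₁ ⊗ₜ[R] alpha κ' A w g' := by
    induction w with
    | zero => simp
    | add x y hx hy => simp only [tmul_add, map_add, LinearMap.add_apply, hx, hy]
    | tmul x y => simp
  rw [LinearMap.lTensor_tmul, slice_apply, alpha_natural, alpha_assoc_symm]

theorem AreDual.form_alpha_rTensor_mul'_slice (h : AreDual κ κ' ψ φ) {d : C'} {ι : Type*}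
    (𝓓 : Coalgebra.Repr R d ι) (t : A ⊗[R] C) (b : A) (g : A') :
    form κ (alpha κ' A ((LinearMap.mul' R A).rTensor C ((TensorProduct.assoc R A A C).symm
      ((slice ψ b).lTensor A t))) g) d =
    ∑ i ∈ 𝓓.index,
      form κ (alpha κ' A t (alpha κ A' (φ (𝓓.right i ⊗ₜ[R] g)) b)) (𝓓.left i) := by
  induction t with
  | zero => simp
  | add x y hx hy => simp only [map_add, LinearMap.add_apply, Finset.sum_add_distrib, hx, hy]
  | tmul x c =>
    rw [alpha_rTensor_mul'_slice, form_mul_eq_sum κ 𝓓]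
    refine Finset.sum_congr rfl fun i _ => ?_
    rw [h c b, alpha_tmul, map_smul, LinearMap.smul_apply, smul_eq_mul, mul_comm]

/-- `∑ ⟨a_ψ b_Ψ, d⟩ ⟨g, c^{ψΨ}⟩ = ∑ ⟨g_{φΦ}, c⟩ ⟨a, d₁^Φ⟩ ⟨b, d₂^φ⟩`, in the notation of
`IsEntwining`. -/
theorem AreDual.form_alpha_mul_eq_form_alpha_comul (h : AreDual κ κ' ψ φ) (c : C) (a b : A)
    (d : C') (g : A') :
    form κ (alpha κ' A ((LinearMap.mul' R A).rTensor C ((TensorProduct.assoc R A A C).symm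
      ((slice ψ b).lTensor A (ψ (c ⊗ₜ[R] a))))) g) d =
    form κ' (alpha κ A' (alpha κ (A' ⊗[R] C') (φ.rTensor C' ((TensorProduct.assoc R C' A' C').symm
      ((slice φ g).lTensor C' (Coalgebra.comul (R := R) d)))) b) a) c := by
  let 𝓓 := Coalgebra.Repr.arbitrary R d
  rw [h.form_alpha_rTensor_mul'_slice 𝓓, ← 𝓓.eq]
  simp only [map_sum, LinearMap.sum_apply, alpha_alpha_rTensor_slice, h c a]

theorem AreDual.isEntwining (h : AreDual κ κ' ψ φ) (hκ : AlphaCondition κ)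
    (hκ' : Function.Injective κ') (hψ : IsEntwining ψ) : IsEntwining φ where
  map_mul d g g' := by
    refine ext_form_alpha hκ hκ' fun a c => ?_
    rw [h.symm.form_alpha_mul_eq_form_alpha_comul, ← h, alpha_mul, hψ.map_comul,
      LinearEquiv.symm_apply_apply]
  map_one d := by
    refine ext_form_alpha hκ hκ' fun a c => ?_
    rw [← h, alpha_one, hψ.map_counit]
    simp [form_one, mul_comm]
  map_comul d g := by
    refine (TensorProduct.assoc R _ _ _).symm.injective (hκ _ (LinearMap.ext fun b =>
      ext_form_alpha hκ hκ' fun a c => ?_))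
    rw [LinearEquiv.symm_apply_apply, ← alpha_mul, ← h, hψ.map_mul,
      h.form_alpha_mul_eq_form_alpha_comul]
  map_counit d g := by
    refine form_injective hκ' (LinearMap.ext fun c => ?_)
    rw [← alpha_one κ, ← h, hψ.map_one]
    simp [form_one, mul_comm]

theorem EntwinedModule.colinear_iff_map_leftAct {M N : EntwinedModule ψ} (hκ' : AlphaCondition κ')
    (f : M.carrier →ₗ[R] N.carrier) :
    (∀ m, N.coact (f m) = f.rTensor C (M.coact m)) ↔
      ∀ g m, f (M.leftAct κ' g m) = N.leftAct κ' g (f m) := by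
  simp only [EntwinedModule.leftAct_apply, ← alpha_natural]
  exact ⟨fun hf g m => by rw [hf], fun hf m => hκ' _ (LinearMap.ext fun g => (hf g m).symm)⟩

theorem coe_dualEntwined_leftAct (M : EntwinedModule ψ) (hκ : AlphaCondition κ)
    (h : AreDual κ κ' ψ φ) (a : A) (x : M.ratDual κ) :
    Subtype.val (p := (· ∈ M.ratDual κ)) ((dualEntwined M hκ h).leftAct κ a x) =
      dualLeft M.act a x :=
  congrArg Subtype.val (LinearMap.congr_fun (alpha_ratCoact hκ (dualLeft M.act) x) a)

variable {M : EntwinedModule ψ} {K : EntwinedModule φ}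

/-- A bilinear form on `M × K` is balanced if `β(m a, k) = β(m, a k)` and `β(g m, k) = β(m, k g)`,
where the left actions are those that the comodule structures induce through `κ` and `κ'`. Balanced
forms are the common description of the two sides of the adjunction. -/
structure IsBalanced (κ : MeasuringPairing R A C') (κ' : MeasuringPairing R A' C)
    (β : M.carrier →ₗ[R] Module.Dual R K.carrier) : Prop where
  act_left : ∀ a m k, β (M.act (op a) m) k = β m (K.leftAct κ a k)
  act_right : ∀ g m k, β (M.leftAct κ' g m) k = β m (K.act (op g) k)

namespace IsBalanced

variable {β : M.carrier →ₗ[R] Module.Dual R K.carrier}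

theorem flip (hβ : IsBalanced κ κ' β) : IsBalanced κ' κ β.flip where
  act_left g k m := (hβ.act_right g m k).symm
  act_right a k m := (hβ.act_left a m k).symm

theorem mem_ratDual (hβ : IsBalanced κ κ' β) (m : M.carrier) : β m ∈ K.ratDual κ' := by
  refine mem_rat.2 ⟨β.rTensor C (M.coact m), fun g => LinearMap.ext fun k => ?_⟩
  rw [alpha_natural]
  exact hβ.act_right g m k

/-- The morphism `m ↦ β(m, -)` to the dual entwined module. -/
def toHom (hβ : IsBalanced κ κ' β) (hκ' : AlphaCondition κ') (h : AreDual κ' κ φ ψ) :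
    M ⟶ dualEntwined K hκ' h where
  toLinearMap := β.codRestrict (K.ratDual κ') hβ.mem_ratDual
  map_act a m := Subtype.ext (LinearMap.ext (hβ.act_left a m))
  map_coact := (EntwinedModule.colinear_iff_map_leftAct hκ' (N := dualEntwined K hκ' h) _).2
    fun g m => Subtype.ext <| (LinearMap.ext (hβ.act_right g m)).trans
      (coe_dualEntwined_leftAct K hκ' h g ⟨β m, hβ.mem_ratDual m⟩).symm

end IsBalanced

theorem isBalanced_subtype_comp (hκ' : AlphaCondition κ') (h : AreDual κ' κ φ ψ)
    (f : M ⟶ dualEntwined K hκ' h) :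
    IsBalanced κ κ' ((K.ratDual κ').subtype ∘ₗ f.toLinearMap) where
  act_left a m k := LinearMap.congr_fun (congrArg Subtype.val (f.map_act a m)) k
  act_right g m k := by
    have map_leftAct :=
      (EntwinedModule.colinear_iff_map_leftAct hκ' f.toLinearMap).1 f.map_coact g m
    exact LinearMap.congr_fun ((congrArg Subtype.val map_leftAct).trans
      (coe_dualEntwined_leftAct K hκ' h g (f.toLinearMap m))) k

/-- Morphisms `M ⟶ Rat^C(_{A'} K*)` are balanced forms on `M × K`, by `f ↦ [(m, k) ↦ f(m)(k)]`. -/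
def homEquivBalanced (hκ' : AlphaCondition κ') (h : AreDual κ' κ φ ψ) :
    (M ⟶ dualEntwined K hκ' h) ≃
      {β : M.carrier →ₗ[R] Module.Dual R K.carrier // IsBalanced κ κ' β} where
  toFun f := ⟨_, isBalanced_subtype_comp hκ' h f⟩
  invFun β := β.2.toHom hκ' h
  left_inv _ := rfl
  right_inv _ := rfl

/-- Exchanging the two arguments of a balanced form. -/
def balancedFlip (M : EntwinedModule ψ) (K : EntwinedModule φ) :
    {β : K.carrier →ₗ[R] Module.Dual R M.carrier // IsBalanced κ' κ β} ≃
      {β : M.carrier →ₗ[R] Module.Dual R K.carrier // IsBalanced κ κ' β} where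
  toFun β := ⟨_, β.2.flip⟩
  invFun β := ⟨_, β.2.flip⟩
  left_inv _ := rfl
  right_inv _ := rfl

/-- The dual functors of an adjoint pair `ψ`, `φ` are adjoint on the right: both hom-sets consist of
the balanced forms on `M × K`. -/
def dualAdjunction (hκ : AlphaCondition κ) (hκ' : AlphaCondition κ') (h : AreDual κ κ' ψ φ) :
    (dualFunctor hκ h).rightOp ⊣ dualFunctor hκ' h.symm :=
  Adjunction.mkOfHomEquiv
    { homEquiv := fun M K => (opEquiv _ _).trans <| (homEquivBalanced hκ h).trans <|
        (balancedFlip M K.unop).trans (homEquivBalanced hκ' h.symm).symm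
      homEquiv_naturality_left_symm := fun _ _ => rfl
      homEquiv_naturality_right := fun _ _ => rfl }

theorem dualAdjunction_homEquiv_apply (hκ : AlphaCondition κ) (hκ' : AlphaCondition κ')
    (h : AreDual κ κ' ψ φ) (g : K ⟶ (dualFunctor hκ h).obj (Opposite.op M)) (m : M.carrier)
    (k : K.carrier) :
    Subtype.val (p := (· ∈ K.ratDual κ'))
        (((dualAdjunction hκ hκ' h).homEquiv M (Opposite.op K) g.op).toLinearMap m) k =
      Subtype.val (p := (· ∈ M.ratDual κ)) (g.toLinearMap k) m :=
  rfl

end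

end Entwined

theorem mainTheorem2_general {R A C A' C' : Type u} [CommRing R] [Semiring A] [Algebra R A]
    [AddCommMonoid C] [Module R C] [Coalgebra R C] [Semiring A'] [Algebra R A']
    [AddCommMonoid C'] [Module R C'] [Coalgebra R C']
    {κ : Entwined.MeasuringPairing R A C'} {κ' : Entwined.MeasuringPairing R A' C}
    {ψ : C ⊗[R] A →ₗ[R] A ⊗[R] C} {φ : C' ⊗[R] A' →ₗ[R] A' ⊗[R] C'}
    (hψ : Entwined.IsEntwining ψ) (h : Entwined.AreDual κ κ' ψ φ)
    (hκ : Entwined.AlphaCondition κ) (hκ' : Entwined.AlphaCondition κ')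
    (hinj : Function.Injective κ') :
    Entwined.IsEntwining φ ∧
      ∃ adj : (Entwined.dualFunctor hκ h).rightOp ⊣ Entwined.dualFunctor hκ' h.symm,
        ∀ (M : Entwined.EntwinedModule ψ) (K : Entwined.EntwinedModule φ)
          (g : K ⟶ (Entwined.dualFunctor hκ h).obj (Opposite.op M)) (m : M.carrier)
          (k : K.carrier),
          Subtype.val (p := (· ∈ K.ratDual κ'))
              ((adj.homEquiv M (Opposite.op K) g.op).toLinearMap m) k =
            Subtype.val (p := (· ∈ M.ratDual κ)) (g.toLinearMap k) m :=
  ⟨h.isEntwining hκ hinj hψ, Entwined.dualAdjunction hκ hκ' h, fun _ _ =>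
    Entwined.dualAdjunction_homEquiv_apply hκ hκ' h⟩

theorem mainTheorem2 {R A C : Type u} [CommRing R] [IsNoetherianRing R]
    [Ring A] [Algebra R A] [Entwined.IsAlphaAlgebra R A]
    [AddCommGroup C] [Module R C] [Coalgebra R C]
    (ψ : C ⊗[R] A →ₗ[R] A ⊗[R] C) (hψ : Entwined.IsEntwining ψ)
    (B : Subalgebra R (WithConv (C →ₗ[R] R))) (D : Entwined.FiniteDualSubcoalgebra R A)
    (φ : D.toSubmodule ⊗[R] B →ₗ[R] B ⊗[R] D.toSubmodule) (hφ : Entwined.IsDualMap ψ B D φ)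
    (hα : Entwined.AlphaCondition B.val) :
    Entwined.IsEntwining φ ∧
      ∃ adj : (Entwined.lowerR hφ).rightOp ⊣ Entwined.upperR hφ hα,
        ∀ (M : Entwined.EntwinedModule ψ) (K : Entwined.EntwinedModule φ)
          (g : K ⟶ (Entwined.lowerR hφ).obj (Opposite.op M)) (m : M.carrier) (k : K.carrier),
          Subtype.val (p := (· ∈ K.ratDual B.val))
              ((adj.homEquiv M (Opposite.op K) g.op).toLinearMap m) k =
            Subtype.val (p := (· ∈ M.ratDual D.pairing)) (g.toLinearMap k) m :=
  mainTheorem2_general hψ hφ.areDual D.alphaCondition hα Subtype.val_injective
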